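/- Let $1\le C<L$ be integers and let $\mu=(\mu_1,\dots,\mu_L)$ be a probability vector with $\mu_1>\mu_2>\cdots>\mu_L\ge 0$. At each time $t=1,2,\dots$ a file $x(t)\in\{1,\dots,L\}$ is requested; the requests are independent with $\mathbb P(x(t)=i)=\mu_i$. A caching algorithm holds a set $C(t)$ of $C$ files at time $t$ and, under partial observation, it sees the request $x(t)$ if $x(t)\in C(t)$ and otherwise learns only that there was a miss. Marginal posterior sampling: set $\alpha_i(1)=\beta_i(1)=1$ for all $i$. At each time $t$, given the past, draw $\hat\mu_i(t)\sim\mathrm{Beta}(\alpha_i(t),\beta_i(t))$, $i=1,\dots,L$, independently of each other and of $x(t)$; let $C(t)$ be the set of indices of the $C$ largest values $\hat\mu_i(t)$; then, for each cached file $i\in C(t)$, increase $\alpha_i$ by $1$ if $x(t)=i$ and increase $\beta_i$ by $1$ if $x(t)\ne i$, and leave the parameters of all files that are not cached unchanged. Let $R(T)=\sum_{t=1}^{T}\bigl(\mathbf 1\{x(t)\in\{1,\dots,C\}\}-\mathbf 1\{x(t)\in C(t)\}\bigr)$ be the regret with respect to always caching the $C$ most popular files, and let $\Delta_{\min}=\mu_C-\mu_{C+1}>0$.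 Then $\mathbb E[R(T)]=O((L-C)\,C\log T)$, with a constant that depends only on $\Delta_{\min}$: there is a function $K$ such that, for all $L$, $C$, $\mu$ as above and all $T\ge 2$, $$\mathbb E[R(T)]\le K(\Delta_{\min})\,(L-C)\,C\,\log T .$$ -/

import Mathlib

open MeasureTheory ProbabilityTheory

noncomputable section

namespace Caching

/-- What happens in one time step: the vector of values sampled by the algorithm, and the file
requested. The library is `Fin L`; index `i : Fin L` is the `(i + 1)`-st most popular file. -/
abbrev Round (L : ℕ) : Type := (Fin L → ℝ) × Fin L

/-- The indices of the `C` largest entries of `v`. Ties are broken in favour of the smaller index,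
so that this set has exactly `min C L` elements. -/
def topC {L : ℕ} (C : ℕ) (v : Fin L → ℝ) : Finset (Fin L) :=
  {i | (Finset.univ.filter fun j => v i < v j ∨ (v j = v i ∧ j < i)).card < C}

/-- The cache content in a round: the files with the `C` largest sampled values. -/
def cache {L : ℕ} (C : ℕ) (r : Round L) : Finset (Fin L) := topC C r.1

/-- Partial observation: the request is seen in the case of a hit only; `none` is a miss. -/
def observation {L : ℕ} (C : ℕ) (r : Round L) : Option (Fin L) :=
  if r.2 ∈ cache C r then some r.2 else none

/-- Round `r` counts as a success for file `i`: `i` is cached and its request is observed. -/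
def IsSuccess {L : ℕ} (C : ℕ) (r : Round L) (i : Fin L) : Prop :=
  i ∈ cache C r ∧ observation C r = some i

/-- Round `r` counts as a failure for file `i`: `i` is cached and no request for it is observed. -/
def IsFailure {L : ℕ} (C : ℕ) (r : Round L) (i : Fin L) : Prop :=
  i ∈ cache C r ∧ observation C r ≠ some i

open Classical in
/-- The numbers of successes and of failures of every file in the rounds `0, …, n`. -/
def counts {L : ℕ} (C n : ℕ) (h : Finset.Iic n → Round L) : Fin L → ℕ × ℕ :=
  fun i => (∑ s, if IsSuccess C (h s) i then 1 else 0, ∑ s, if IsFailure C (h s) i then 1 else 0)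

/-- Independent samples, that of file `i` from the posterior `Beta (1 + successes, 1 + failures)`
of file `i` (the prior is `Beta (1, 1)`). -/
def samplingLaw {L : ℕ} (k : Fin L → ℕ × ℕ) : Measure (Fin L → ℝ) :=
  Measure.pi fun i => betaMeasure (1 + ((k i).1 : ℝ)) (1 + ((k i).2 : ℝ))

instance {L : ℕ} (k : Fin L → ℕ × ℕ) : IsProbabilityMeasure (samplingLaw k) := by
  have : ∀ i, IsProbabilityMeasure (betaMeasure (1 + ((k i).1 : ℝ)) (1 + ((k i).2 : ℝ))) :=
    fun i => isProbabilityMeasureBeta (by positivity) (by positivity)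
  unfold samplingLaw
  infer_instance

/-- One round of the algorithm when the current success and failure counts are `k`: the values are
sampled from the current posteriors, and the request is drawn from `μ` independently of them. -/
def roundKernel {L : ℕ} (μ : PMF (Fin L)) : Kernel (Fin L → ℕ × ℕ) (Round L) where
  toFun k := (samplingLaw k).prod μ.toMeasure
  measurable' := measurable_of_countable _

instance {L : ℕ} (μ : PMF (Fin L)) : IsMarkovKernel (roundKernel μ) :=
  ⟨fun k => by
    change IsProbabilityMeasure ((samplingLaw k).prod μ.toMeasure)
    infer_instance⟩

lemma measurableSet_mem_cache {L : ℕ} (C : ℕ) (i : Fin L) :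
    MeasurableSet {r : Round L | i ∈ cache C r} := by
  have h : {r : Round L | i ∈ cache C r} = (fun r : Round L =>
      ∑ j, if r.1 i < r.1 j ∨ (r.1 j = r.1 i ∧ j < i) then 1 else 0) ⁻¹' Set.Iio C := by
    ext r
    simp only [cache, topC, Finset.card_filter, Finset.mem_filter, Finset.mem_univ, true_and,
      Set.mem_ofPred_eq, Set.mem_preimage, Set.mem_Iio]
  have hv (j : Fin L) : Measurable fun r : Round L => r.1 j :=
    (measurable_pi_apply j).comp measurable_fst
  rw [h]
  refine (Finset.measurable_sum _ fun j _ => Measurable.ite ?_ measurable_const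
    measurable_const) measurableSet_Iio
  exact (measurableSet_lt (hv i) (hv j)).union
    ((measurableSet_eq_fun (hv j) (hv i)).inter (MeasurableSet.const _))

lemma isSuccess_iff {L : ℕ} (C : ℕ) (r : Round L) (i : Fin L) :
    IsSuccess C r i ↔ i ∈ cache C r ∧ r.2 = i := by
  unfold IsSuccess observation
  split_ifs with h <;> grind

lemma isFailure_iff {L : ℕ} (C : ℕ) (r : Round L) (i : Fin L) :
    IsFailure C r i ↔ i ∈ cache C r ∧ r.2 ≠ i := by
  unfold IsFailure observation
  split_ifs with h <;> grind

lemma measurable_counts {L : ℕ} (C n : ℕ) :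
    Measurable (counts C n : (Finset.Iic n → Round L) → Fin L → ℕ × ℕ) := by
  classical
  have hx (i : Fin L) : MeasurableSet {r : Round L | r.2 = i} :=
    measurable_snd (measurableSet_singleton i)
  have hs (i : Fin L) : MeasurableSet {r : Round L | IsSuccess C r i} := by
    simp only [isSuccess_iff]
    exact (measurableSet_mem_cache C i).inter (hx i)
  have hf (i : Fin L) : MeasurableSet {r : Round L | IsFailure C r i} := by
    simp only [isFailure_iff]
    exact (measurableSet_mem_cache C i).inter (hx i).compl
  refine measurable_pi_lambda _ fun i => Measurable.prodMk ?_ ?_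
  · exact Finset.measurable_sum _ fun s _ =>
      Measurable.ite
        ((measurable_pi_apply (X := fun _ => Round L) s) (hs i)) measurable_const measurable_const
  · exact Finset.measurable_sum _ fun s _ =>
      Measurable.ite
        ((measurable_pi_apply (X := fun _ => Round L) s) (hf i)) measurable_const measurable_const

/-- The law of the next round given the rounds `0, …, n`. -/
def nextRound {L : ℕ} (μ : PMF (Fin L)) (C n : ℕ) : Kernel (Finset.Iic n → Round L) (Round L) :=
  (roundKernel μ).comap (counts C n) (measurable_counts C n)

instance {L : ℕ} (μ : PMF (Fin L)) (C n : ℕ) : IsMarkovKernel (nextRound μ C n) := by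
  unfold nextRound
  infer_instance

/-- The law of the infinite sequence of rounds when marginal posterior sampling is run with cache
size `C` against independent requests with popularity profile `μ`. Round `t` here is time
`t + 1`; all counts are zero at the start. -/
def mpsLaw {L : ℕ} (μ : PMF (Fin L)) (C : ℕ) : Measure (ℕ → Round L) :=
  Kernel.trajMeasure (X := fun _ => Round L) (roundKernel μ fun _ => (0, 0)) (nextRound μ C)

/-- Cumulative regret after `T` steps: hits of the cache that always holds the `C` most popular
files, minus hits of the algorithm. -/
def regret {L : ℕ} (C T : ℕ) (ω : ℕ → Round L) : ℝ :=
  ∑ t ∈ Finset.range T,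
    ((if ((ω t).2 : ℕ) < C then 1 else 0) - (if (ω t).2 ∈ cache C (ω t) then 1 else 0))

/-- The gap between the popularities of the `C`-th and the `(C + 1)`-st most popular file. -/
def gap {L : ℕ} (μ : PMF (Fin L)) (C : ℕ) (hCL : C < L) : ℝ :=
  (μ ⟨C - 1, by omega⟩).toReal - (μ ⟨C, hCL⟩).toReal

end Caching

end

/-!
Fix an unpopular file `j` and a level `y` strictly between its popularity and those of the popular
files. If `j` is cached, then either its sample exceeds `y`, or it is cached on a value at most `y`
while some popular file `i` is displaced.

Once `j` has been cached `O(log T)` times and its empirical frequency is below `y` by a margin, its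
posterior exceeds `y` with probability `O(1 / T)`; by Chernoff's bound, the expected number of
rounds in which `j` is cached although its empirical frequency is not below `y` by this margin is
`O(1)`.

If `j` is cached on a value at most `y` while `i` is displaced, then redrawing the sample of `i`
above `y` puts `i` into the cache. Given the past, the probability of this displacement is therefore
at most `1 / p - 1` times the probability that `i` is cached, where `p` is the posterior probability
that the sample of `i` exceeds `y`.

Both costs are thus charged only to rounds in which the file concerned is cached, and these are
exactly the rounds in which its counts record one more Bernoulli trial. Hence the expected total
cost is at most that along an uninterrupted sequence of trials, and the expectation of `1 / p - 1`
after `k` trials is summable in `k`.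
-/

noncomputable section

open Finset
open scoped ENNReal

namespace Caching

/-! ### Binomial weights -/

section BinomialWeight

/-- The term with exponents `m = (a, b)` in the expansion of `(p + q) ^ (a + b)`. For `p + q = 1` it
is the probability of `a` successes and `b` failures in `a + b` Bernoulli trials, or the likelihood
of `p` given these data. -/
def binomialWeight {R : Type*} [CommSemiring R] (p q : R) (m : ℕ × ℕ) : R :=
  (m.1 + m.2).choose m.1 * p ^ m.1 * q ^ m.2

section CommSemiring

variable {R : Type*} [CommSemiring R]

lemma binomialWeight_swap (p q : R) (m : ℕ × ℕ) :
    binomialWeight p q m.swap = binomialWeight q p m := by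
  rw [binomialWeight, binomialWeight, Prod.fst_swap, Prod.snd_swap, add_comm m.2,
    Nat.choose_symm_add]
  ring

lemma sum_antidiagonal_binomialWeight (p q : R) (k : ℕ) :
    ∑ m ∈ antidiagonal k, binomialWeight p q m = (p + q) ^ k := by
  rw [(Commute.all p q).add_pow']
  refine sum_congr rfl fun m hm => ?_
  rw [binomialWeight, mem_antidiagonal.1 hm, nsmul_eq_mul, mul_assoc]

lemma sum_antidiagonal_succ_binomialWeight_mul (p q : R) (f : ℕ × ℕ → R) (k : ℕ) :
    ∑ m ∈ antidiagonal (k + 1), binomialWeight p q m * f m =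
      p * ∑ m ∈ antidiagonal k, binomialWeight p q m * f (m + (1, 0)) +
        q * ∑ m ∈ antidiagonal k, binomialWeight p q m * f (m + (0, 1)) := by
  have pascal := sum_antidiagonal_choose_succ_mul (fun a b => p ^ a * q ^ b * f (a, b)) k
  calc ∑ m ∈ antidiagonal (k + 1), binomialWeight p q m * f m
      = ∑ m ∈ antidiagonal (k + 1), (k + 1).choose m.1 * (p ^ m.1 * q ^ m.2 * f (m.1, m.2)) :=
        sum_congr rfl fun m hm => by
          rw [binomialWeight, mem_antidiagonal.1 hm]
          ring
    _ = _ := by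
        rw [pascal, add_comm, mul_sum, mul_sum]
        congr 1 <;> refine sum_congr rfl fun m hm => ?_
        · rw [binomialWeight, Nat.choose_symm_add, mem_antidiagonal.1 hm, Prod.add_def]
          ring_nf
        · rw [binomialWeight, mem_antidiagonal.1 hm, Prod.add_def]
          ring_nf

/-- For `p + q = 1`, the expected sum of `φ` over the first `n` pairs (successes, failures) recorded
in the course of Bernoulli trials with success probability `p`, when the record starts from `m`. -/
def cumulativeCost (p q : R) (φ : ℕ × ℕ → R) (n : ℕ) (m : ℕ × ℕ) : R :=
  ∑ k ∈ range n, ∑ l ∈ antidiagonal k, binomialWeight p q l * φ (m + l)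

lemma cumulativeCost_succ (p q : R) (φ : ℕ × ℕ → R) (n : ℕ) (m : ℕ × ℕ) :
    cumulativeCost p q φ (n + 1) m = φ m +
      (p * cumulativeCost p q φ n (m + (1, 0)) + q * cumulativeCost p q φ n (m + (0, 1))) := by
  have hstart : ∑ l ∈ antidiagonal 0, binomialWeight p q l * φ (m + l) = φ m := by
    simp [binomialWeight, Prod.mk_zero_zero]
  rw [cumulativeCost, sum_range_succ', hstart, add_comm]
  simp only [sum_antidiagonal_succ_binomialWeight_mul, sum_add_distrib, cumulativeCost, mul_sum,
    add_assoc, add_comm (1, 0), add_comm (0, 1)]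

end CommSemiring

lemma cumulativeCost_le_succ (p q : ℝ≥0∞) (φ : ℕ × ℕ → ℝ≥0∞) (n : ℕ) (m : ℕ × ℕ) :
    cumulativeCost p q φ n m ≤ cumulativeCost p q φ (n + 1) m := by
  rw [cumulativeCost, cumulativeCost, sum_range_succ]
  exact le_self_add

lemma ofReal_binomialWeight {p q : ℝ} (hp : 0 ≤ p) (hq : 0 ≤ q) (m : ℕ × ℕ) :
    ENNReal.ofReal (binomialWeight p q m) =
      binomialWeight (ENNReal.ofReal p) (ENNReal.ofReal q) m := by
  rw [binomialWeight, binomialWeight, ENNReal.ofReal_mul (by positivity),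
    ENNReal.ofReal_mul (by positivity), ENNReal.ofReal_pow hp, ENNReal.ofReal_pow hq,
    ENNReal.ofReal_natCast]

lemma binomialWeight_nonneg {p q : ℝ} (hp : 0 ≤ p) (hq : 0 ≤ q) (m : ℕ × ℕ) :
    0 ≤ binomialWeight p q m := by
  unfold binomialWeight
  positivity

lemma ofReal_cumulativeCost {p q : ℝ} (hp : 0 ≤ p) (hq : 0 ≤ q) {ψ : ℕ × ℕ → ℝ}
    (hψ : ∀ m, 0 ≤ ψ m) (n : ℕ) (m : ℕ × ℕ) :
    ENNReal.ofReal (cumulativeCost p q ψ n m) =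
      cumulativeCost (ENNReal.ofReal p) (ENNReal.ofReal q) (fun l => ENNReal.ofReal (ψ l)) n m := by
  have hterm (l : ℕ × ℕ) : 0 ≤ binomialWeight p q l * ψ (m + l) :=
    mul_nonneg (binomialWeight_nonneg hp hq l) (hψ _)
  rw [cumulativeCost, ENNReal.ofReal_sum_of_nonneg fun k _ => sum_nonneg fun l _ => hterm l]
  refine sum_congr rfl fun k _ => ?_
  rw [ENNReal.ofReal_sum_of_nonneg fun l _ => hterm l]
  refine sum_congr rfl fun l _ => ?_
  rw [ENNReal.ofReal_mul (binomialWeight_nonneg hp hq l), ofReal_binomialWeight hp hq]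

lemma binomialWeight_le_one {q : ℝ} (h0 : 0 ≤ q) (h1 : q ≤ 1) (m : ℕ × ℕ) :
    binomialWeight q (1 - q) m ≤ 1 := by
  have hsum := sum_antidiagonal_binomialWeight q (1 - q) (m.1 + m.2)
  rw [add_sub_cancel, one_pow] at hsum
  calc binomialWeight q (1 - q) m
      ≤ ∑ m' ∈ antidiagonal (m.1 + m.2), binomialWeight q (1 - q) m' :=
        single_le_sum (fun m' _ => binomialWeight_nonneg h0 (sub_nonneg.2 h1) m')
          (mem_antidiagonal.2 rfl)
    _ = 1 := hsum

lemma pow_le_binomialWeight {p q r : ℝ} (hr : 0 ≤ r) (hp : r ≤ p) (hq : r ≤ q) (m : ℕ × ℕ) :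
    r ^ (m.1 + m.2) ≤ binomialWeight p q m := by
  have hchoose : (1 : ℝ) ≤ (m.1 + m.2).choose m.1 := by
    exact_mod_cast Nat.choose_pos (Nat.le_add_right m.1 m.2)
  have hp0 : 0 ≤ p := hr.trans hp
  calc r ^ (m.1 + m.2) = 1 * r ^ m.1 * r ^ m.2 := by rw [pow_add, one_mul]
    _ ≤ binomialWeight p q m := by
        unfold binomialWeight
        gcongr

/-! ### Likelihood ratios and the Chernoff bound -/

lemma one_sub_le_exp_neg_add_sq_div_two {v : ℝ} (hv : 0 ≤ v) :
    1 - v ≤ Real.exp (-(v + v ^ 2 / 2)) := by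
  rcases le_or_gt 1 v with h1 | h1
  · exact (sub_nonpos.2 h1).trans (Real.exp_pos _).le
  have hlog : v + v ^ 2 / 2 ≤ -Real.log (1 - v) := by
    have := sum_le_hasSum (range 2) (fun i _ => by positivity)
      (Real.hasSum_pow_div_log_of_abs_lt_one (x := v) (by rwa [abs_of_nonneg hv]))
    norm_num [sum_range_succ] at this
    exact this
  rw [← Real.exp_log (sub_pos.2 h1), Real.exp_le_exp]
  linarith

lemma pow_le_exp_mul_pow {q z n : ℝ} {a : ℕ} (hz : 0 ≤ z) (hzq : z ≤ q) (hn : 0 ≤ n)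
    (ha : a ≤ z * n) : q ^ a ≤ Real.exp (n * (q - z)) * z ^ a := by
  rcases hz.eq_or_lt with rfl | hz
  · obtain rfl : a = 0 := by
      rw [zero_mul] at ha
      exact_mod_cast ha.antisymm a.cast_nonneg
    simpa using mul_nonneg hn hzq
  have hratio : q ≤ Real.exp ((q - z) / z) * z := by
    rw [← div_le_iff₀ hz]
    have := Real.add_one_le_exp ((q - z) / z)
    rwa [sub_div, div_self hz.ne', sub_add_cancel, ← div_self hz.ne', ← sub_div] at this
  have hexponent : a * ((q - z) / z) ≤ n * (q - z) := by
    rw [← mul_div_assoc, div_le_iff₀ hz]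
    nlinarith [sub_nonneg.2 hzq]
  calc q ^ a ≤ (Real.exp ((q - z) / z) * z) ^ a := by
        have : 0 ≤ q := hz.le.trans hzq
        gcongr
    _ = Real.exp (a * ((q - z) / z)) * z ^ a := by rw [mul_pow, Real.exp_nat_mul]
    _ ≤ Real.exp (n * (q - z)) * z ^ a := by gcongr

lemma pow_le_exp_neg_mul_pow {r s n : ℝ} {b : ℕ} (hs : 0 ≤ s) (hsr : s ≤ r) (hr : r ≤ 1)
    (hb : r * n ≤ b) :
    s ^ b ≤ Real.exp (-(n * ((r - s) + (r - s) ^ 2 / 2))) * r ^ b := by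
  rcases (hs.trans hsr).eq_or_lt with rfl | hr0
  · obtain rfl : s = 0 := hsr.antisymm hs
    simp
  set v := (r - s) / r with hv
  have hv0 : 0 ≤ v := div_nonneg (sub_nonneg.2 hsr) hr0.le
  have hrv : r * v = r - s := by rw [hv]; field_simp
  have hratio : s ≤ Real.exp (-(v + v ^ 2 / 2)) * r :=
    calc s = (1 - v) * r := by linarith
      _ ≤ _ := by gcongr; exact one_sub_le_exp_neg_add_sq_div_two hv0
  have hlinear : n * (r - s) ≤ b * v := by
    rw [← hrv, ← mul_assoc, mul_comm n]
    gcongr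
  have hsquare : n * (r - s) ^ 2 ≤ b * v ^ 2 :=
    calc n * (r - s) ^ 2 = n * (r - s) * (r * v) := by rw [hrv]; ring
      _ ≤ b * v * (1 * v) := by gcongr
      _ = b * v ^ 2 := by ring
  calc s ^ b ≤ (Real.exp (-(v + v ^ 2 / 2)) * r) ^ b := by gcongr
    _ = Real.exp (b * -(v + v ^ 2 / 2)) * r ^ b := by rw [mul_pow, Real.exp_nat_mul]
    _ ≤ _ := by
        gcongr
        linarith

lemma binomialWeight_le_exp_mul {q z : ℝ} (hz : 0 ≤ z) (hzq : z ≤ q) (hq : q ≤ 1) {m : ℕ × ℕ}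
    (hm : m.1 ≤ z * (m.1 + m.2)) :
    binomialWeight q (1 - q) m ≤
      Real.exp (-((m.1 + m.2) * ((q - z) ^ 2 / 2))) * binomialWeight z (1 - z) m := by
  set n : ℝ := m.1 + m.2
  have hn0 : 0 ≤ n := by positivity
  have hsuccess := pow_le_exp_mul_pow hz hzq hn0 hm
  have hfailure : (1 - q) ^ m.2 ≤
      Real.exp (-(n * ((q - z) + (q - z) ^ 2 / 2))) * (1 - z) ^ m.2 := by
    have := pow_le_exp_neg_mul_pow (sub_nonneg.2 hq) (sub_le_sub_left hzq 1) (by linarith)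
      (n := n) (b := m.2) (by linarith)
    rwa [sub_sub_sub_cancel_left] at this
  have : 0 ≤ 1 - q := sub_nonneg.2 hq
  have hexp : Real.exp (-(n * ((q - z) ^ 2 / 2))) =
      Real.exp (n * (q - z)) * Real.exp (-(n * ((q - z) + (q - z) ^ 2 / 2))) := by
    rw [← Real.exp_add]
    ring_nf
  calc binomialWeight q (1 - q) m
      ≤ (m.1 + m.2).choose m.1 * (Real.exp (n * (q - z)) * z ^ m.1) *
          (Real.exp (-(n * ((q - z) + (q - z) ^ 2 / 2))) * (1 - z) ^ m.2) := by
        unfold binomialWeight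
        gcongr
    _ = _ := by
        rw [hexp, binomialWeight]
        ring

lemma binomialWeight_le_exp_of_le_mul {q x : ℝ} (hx : 0 ≤ x) (hxq : x ≤ q) (hq : q ≤ 1)
    {m : ℕ × ℕ} (hm : m.1 ≤ x * (m.1 + m.2)) :
    binomialWeight q (1 - q) m ≤ Real.exp (-((m.1 + m.2) * ((q - x) ^ 2 / 2))) :=
  (binomialWeight_le_exp_mul hx hxq hq hm).trans
    (mul_le_of_le_one_right (Real.exp_pos _).le (binomialWeight_le_one hx (hxq.trans hq) m))

lemma binomialWeight_le_exp_of_mul_le {q x : ℝ} (hq : 0 ≤ q) (hqx : q ≤ x) (hx : x ≤ 1)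
    {m : ℕ × ℕ} (hm : x * (m.1 + m.2) ≤ m.1) :
    binomialWeight q (1 - q) m ≤ Real.exp (-((m.1 + m.2) * ((x - q) ^ 2 / 2))) := by
  have h := binomialWeight_le_exp_of_le_mul (m := m.swap) (sub_nonneg.2 hx)
    (sub_le_sub_left hqx 1) (sub_le_self 1 hq)
    (by simp only [Prod.fst_swap, Prod.snd_swap]; linarith)
  rw [binomialWeight_swap, sub_sub_cancel, sub_sub_sub_cancel_left, Prod.fst_swap, Prod.snd_swap,
    add_comm (m.2 : ℝ)] at h
  exact h

end BinomialWeight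

section BetaPosterior

/-! ### Beta posteriors -/

/-- The posterior of a Bernoulli parameter with uniform prior after `m.1` successes and `m.2`
failures. -/
def posterior (m : ℕ × ℕ) : Measure ℝ :=
  betaMeasure (1 + (m.1 : ℝ)) (1 + (m.2 : ℝ))

instance (m : ℕ × ℕ) : IsProbabilityMeasure (posterior m) :=
  isProbabilityMeasureBeta (by positivity) (by positivity)

lemma one_div_beta_one_add (a b : ℕ) :
    1 / beta (1 + a) (1 + b) = (a + b + 1) * (a + b).choose a := by
  have hfactorial := Nat.add_choose_mul_factorial_mul_factorial a b
  rw [← Nat.choose_symm_add] at hfactorial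
  have hsum : (1 + a + (1 + b) : ℝ) = ((a + b + 1 : ℕ) : ℝ) + 1 := by
    push_cast
    ring
  rw [beta, hsum, add_comm (1 : ℝ) a, add_comm (1 : ℝ) b, Real.Gamma_nat_eq_factorial,
    Real.Gamma_nat_eq_factorial, Real.Gamma_nat_eq_factorial, Nat.factorial_succ, ← hfactorial]
  have ha : (a.factorial : ℝ) ≠ 0 := by positivity
  have hb : (b.factorial : ℝ) ≠ 0 := by positivity
  push_cast
  field_simp

lemma betaPDFReal_one_add {x : ℝ} (h0 : 0 < x) (h1 : x < 1) (m : ℕ × ℕ) :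
    betaPDFReal (1 + m.1) (1 + m.2) x = (m.1 + m.2 + 1) * binomialWeight x (1 - x) m := by
  rw [betaPDFReal, if_pos ⟨h0, h1⟩, one_div_beta_one_add, binomialWeight]
  simp only [add_sub_cancel_left, Real.rpow_natCast]
  ring

lemma posterior_apply {m : ℕ × ℕ} {S : Set ℝ} (hS : MeasurableSet S) :
    posterior m S = ∫⁻ x in S ∩ Set.Ioo 0 1,
      ENNReal.ofReal ((m.1 + m.2 + 1) * binomialWeight x (1 - x) m) := by
  have hdensity (x : ℝ) : betaPDF (1 + m.1) (1 + m.2) x = (Set.Ioo 0 1).indicator (fun x =>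
      ENNReal.ofReal ((m.1 + m.2 + 1) * binomialWeight x (1 - x) m)) x := by
    by_cases hx : x ∈ Set.Ioo (0 : ℝ) 1
    · rw [Set.indicator_of_mem hx, betaPDF, betaPDFReal_one_add hx.1 hx.2]
    · rw [Set.indicator_of_notMem hx, betaPDF, betaPDFReal, if_neg (by exact hx),
        ENNReal.ofReal_zero]
  rw [posterior, betaMeasure, withDensity_apply _ hS, Set.inter_comm,
    ← Measure.restrict_restrict measurableSet_Ioo, ← lintegral_indicator measurableSet_Ioo]
  exact lintegral_congr hdensity

lemma posterior_le {m : ℕ × ℕ} {S : Set ℝ} (hS : MeasurableSet S) {c : ℝ}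
    (h : ∀ x ∈ S, 0 < x → x < 1 → binomialWeight x (1 - x) m ≤ c) :
    posterior m S ≤ ENNReal.ofReal ((m.1 + m.2 + 1) * c) := by
  rw [posterior_apply hS]
  calc _ ≤ ∫⁻ _ in S ∩ Set.Ioo 0 1, ENNReal.ofReal ((m.1 + m.2 + 1) * c) := by
        refine setLIntegral_mono measurable_const fun x hx => ENNReal.ofReal_le_ofReal ?_
        gcongr
        exact h x hx.1 hx.2.1 hx.2.2
    _ ≤ ENNReal.ofReal ((m.1 + m.2 + 1) * c) * volume (Set.Ioo (0 : ℝ) 1) := by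
        rw [setLIntegral_const]
        gcongr
        exact Set.inter_subset_right
    _ = _ := by rw [Real.volume_Ioo, sub_zero, ENNReal.ofReal_one, mul_one]

lemma le_posterior_Ioo {m : ℕ × ℕ} {z d c : ℝ} (hz : 0 ≤ z) (hzd : z + d ≤ 1) (hc : 0 ≤ c)
    (h : ∀ x ∈ Set.Ioo z (z + d), c ≤ binomialWeight x (1 - x) m) :
    ENNReal.ofReal (d * c) ≤ posterior m (Set.Ioo z (z + d)) := by
  rw [posterior_apply measurableSet_Ioo, Set.inter_eq_left.2 (Set.Ioo_subset_Ioo hz hzd)]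
  calc ENNReal.ofReal (d * c) = ∫⁻ _ in Set.Ioo z (z + d), ENNReal.ofReal c := by
        rw [setLIntegral_const, Real.volume_Ioo, add_sub_cancel_left, ← ENNReal.ofReal_mul hc,
          mul_comm]
    _ ≤ _ := by
        refine setLIntegral_mono' measurableSet_Ioo fun x hx => ENNReal.ofReal_le_ofReal ?_
        have hn : (1 : ℝ) ≤ m.1 + m.2 + 1 := le_add_of_nonneg_left (by positivity)
        exact (h x hx).trans (le_mul_of_one_le_left (hc.trans (h x hx)) hn)

/-! ### Concentration of the posterior -/

/-- The Chernoff bound for `k` trials with deviation `d`, times the factor `k + 1` lost in passing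
from likelihoods to posterior densities. -/
def tailBound (d : ℝ) (k : ℕ) : ℝ := (k + 1) * Real.exp (-(k * (d ^ 2 / 2)))

lemma tailBound_nonneg (d : ℝ) (k : ℕ) : 0 ≤ tailBound d k := by
  unfold tailBound
  positivity

lemma summable_tailBound {d : ℝ} (hd : 0 < d) : Summable (tailBound d) := by
  have hr : 0 < d ^ 2 / 2 := by positivity
  refine ((Real.summable_pow_mul_exp_neg_nat_mul 1 hr).add
    (Real.summable_pow_mul_exp_neg_nat_mul 0 hr)).congr fun k => ?_
  rw [tailBound, pow_one, pow_zero, add_mul, neg_mul, mul_comm (d ^ 2 / 2)]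

lemma tailBound_le_of_log_le {d s : ℝ} (hd : 0 < d) (hs : 0 < s) {k : ℕ}
    (hk : 4 / d ^ 2 * Real.log s ≤ k) : tailBound d k ≤ (4 / d ^ 2 + 1) / s := by
  set r := d ^ 2 / 4 with hr
  have hr0 : 0 < r := by positivity
  have hr_inv : 4 / d ^ 2 = r⁻¹ := by rw [hr, inv_div]
  rw [hr_inv] at hk ⊢
  have hlog : Real.log s ≤ k * r := by
    rwa [inv_mul_le_iff₀ hr0, mul_comm] at hk
  have hdecay : Real.exp (-(k * r)) ≤ s⁻¹ := by
    rw [← Real.exp_log hs, ← Real.exp_neg, Real.exp_le_exp]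
    linarith
  have hpoly : (k + 1) * Real.exp (-(k * r)) ≤ r⁻¹ + 1 := by
    rw [Real.exp_neg, ← div_eq_mul_inv, div_le_iff₀ (Real.exp_pos _), add_mul, one_mul]
    refine add_le_add ?_ (Real.one_le_exp (by positivity))
    rw [inv_mul_eq_div, le_div_iff₀ hr0]
    linarith [Real.add_one_le_exp (k * r)]
  calc tailBound d k = (k + 1) * Real.exp (-(k * r)) * Real.exp (-(k * r)) := by
        rw [tailBound, mul_assoc, ← Real.exp_add, hr]
        ring_nf
    _ ≤ (r⁻¹ + 1) * s⁻¹ := by gcongr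
    _ = _ := (div_eq_mul_inv _ _).symm

lemma posterior_Ioi_le {m : ℕ × ℕ} {x d : ℝ} (hx : 0 ≤ x) (hd : 0 ≤ d)
    (hm : m.1 ≤ x * (m.1 + m.2)) :
    posterior m (Set.Ioi (x + d)) ≤ ENNReal.ofReal (tailBound d (m.1 + m.2)) := by
  have h := posterior_le (m := m) (S := Set.Ioi (x + d)) measurableSet_Ioi
    (c := Real.exp (-((m.1 + m.2) * (d ^ 2 / 2)))) fun z hz _ hz1 => by
      have hdz : d ≤ z - x := by linarith [Set.mem_Ioi.1 hz]
      refine (binomialWeight_le_exp_of_le_mul hx (by linarith) hz1.le hm).trans ?_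
      gcongr
  exact h.trans_eq (by rw [tailBound]; push_cast; rfl)

lemma posterior_Iic_le {m : ℕ × ℕ} {x d : ℝ} (hx : x ≤ 1) (hd : 0 ≤ d)
    (hm : x * (m.1 + m.2) ≤ m.1) :
    posterior m (Set.Iic (x - d)) ≤ ENNReal.ofReal (tailBound d (m.1 + m.2)) := by
  have h := posterior_le (m := m) (S := Set.Iic (x - d)) measurableSet_Iic
    (c := Real.exp (-((m.1 + m.2) * (d ^ 2 / 2)))) fun z hz hz0 _ => by
      have hdz : d ≤ x - z := by linarith [Set.mem_Iic.1 hz]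
      refine (binomialWeight_le_exp_of_mul_le hz0.le (by linarith) hx hm).trans ?_
      gcongr
  exact h.trans_eq (by rw [tailBound]; push_cast; rfl)

/-! ### The inverse exceedance probability -/

/-- The probability that a sample from `posterior m` exceeds `y`. -/
def exceedProb (y : ℝ) (m : ℕ × ℕ) : ℝ := (posterior m).real (Set.Ioi y)

lemma exceedProb_le_one (y : ℝ) (m : ℕ × ℕ) : exceedProb y m ≤ 1 := measureReal_le_one

lemma mul_le_exceedProb {m : ℕ × ℕ} {y z d c : ℝ} (hyz : y ≤ z) (hz : 0 ≤ z) (hzd : z + d ≤ 1)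
    (hc : 0 ≤ c) (h : ∀ x ∈ Set.Ioo z (z + d), c ≤ binomialWeight x (1 - x) m) :
    d * c ≤ exceedProb y m :=
  (ENNReal.ofReal_le_iff_le_toReal (measure_ne_top _ _)).1
    ((le_posterior_Ioo hz hzd hc h).trans
      (measure_mono (Set.Ioo_subset_Ioi_self.trans (Set.Ioi_subset_Ioi hyz))))

lemma pow_le_exceedProb {y d : ℝ} (hd : 0 ≤ d) (hy : d ≤ y) (hyd : y + 2 * d ≤ 1) (m : ℕ × ℕ) :
    d ^ (m.1 + m.2 + 1) ≤ exceedProb y m := by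
  rw [pow_succ']
  refine mul_le_exceedProb le_rfl (hd.trans hy) (by linarith) (by positivity) fun x hx => ?_
  exact pow_le_binomialWeight hd (hy.trans hx.1.le) (by linarith [hx.2]) m

lemma exceedProb_pos {y d : ℝ} (hd : 0 < d) (hy : d ≤ y) (hyd : y + 2 * d ≤ 1) (m : ℕ × ℕ) :
    0 < exceedProb y m :=
  (pow_pos hd _).trans_le (pow_le_exceedProb hd.le hy hyd m)

/-- A summable bound for the expectation of `1 / exceedProb y m - 1` when `m` records `k` Bernoulli
trials with parameter at least `y + 3 * d`. The first summand accounts for data with a low empirical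
mean; the second one for the remaining data, where the crude bound `d ^ (k + 1)` on the exceedance
probability serves for the finitely many `k` that are too small for concentration. -/
def inverseBound (d : ℝ) (k : ℕ) : ℝ :=
  tailBound d k / d + if tailBound d k ≤ 1 / 2 then 2 * tailBound d k else d⁻¹ ^ (k + 1)

lemma inverseBound_nonneg {d : ℝ} (hd : 0 < d) (k : ℕ) : 0 ≤ inverseBound d k := by
  have := tailBound_nonneg d k
  unfold inverseBound
  positivity

lemma summable_inverseBound {d : ℝ} (hd : 0 < d) : Summable (inverseBound d) := by
  have htail := summable_tailBound hd
  refine (htail.div_const d).add ((htail.mul_left 2).congr_cofinite ?_)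
  have hsmall : ∀ᶠ k in Filter.cofinite, tailBound d k ≤ 1 / 2 :=
    htail.tendsto_cofinite_zero.eventually_le_const one_half_pos
  filter_upwards [hsmall] with k hk
  rw [if_pos hk]

lemma binomialWeight_mul_inv_exceedProb_le {m : ℕ × ℕ} {d y q : ℝ} (hd : 0 < d) (hy : d ≤ y)
    (hyq : y + 3 * d ≤ q) (hq : q ≤ 1) (hm : m.1 ≤ (y + d) * (m.1 + m.2)) :
    binomialWeight q (1 - q) m * (exceedProb y m)⁻¹ ≤
      Real.exp (-((m.1 + m.2) * (d ^ 2 / 2))) / d := by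
  have hm_mono {x : ℝ} (hx : y + d ≤ x) : m.1 ≤ x * (m.1 + m.2) := hm.trans (by gcongr)
  -- The likelihoods of `q` and of the samples above `y` are compared through that of `z`.
  set z := y + 2 * d
  have hw : 0 ≤ binomialWeight z (1 - z) m := binomialWeight_nonneg (by linarith) (by linarith) m
  have hexceed : d * binomialWeight z (1 - z) m ≤ exceedProb y m := by
    refine mul_le_exceedProb (z := y + d) (by linarith) (by linarith) (by linarith) hw
      fun x hx => ?_
    have hx0 : 0 ≤ x := by linarith [hx.1]
    have hxz : x ≤ z := by linarith [hx.2]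
    refine (binomialWeight_le_exp_mul hx0 hxz (by linarith) (hm_mono hx.1.le)).trans ?_
    exact mul_le_of_le_one_left (binomialWeight_nonneg hx0 (by linarith) m)
      (Real.exp_le_one_iff.2 (neg_nonpos.2 (by positivity)))
  rw [← div_eq_mul_inv, div_le_div_iff₀ (exceedProb_pos hd hy (by linarith) m) hd]
  calc binomialWeight q (1 - q) m * d
      ≤ Real.exp (-((m.1 + m.2) * ((q - z) ^ 2 / 2))) * binomialWeight z (1 - z) m * d := by
        gcongr
        exact binomialWeight_le_exp_mul (by linarith) (by linarith) hq (hm_mono (by linarith))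
    _ = Real.exp (-((m.1 + m.2) * ((q - z) ^ 2 / 2))) * (d * binomialWeight z (1 - z) m) := by
        ring
    _ ≤ Real.exp (-((m.1 + m.2) * (d ^ 2 / 2))) * exceedProb y m := by
        have : d ≤ q - z := by linarith
        gcongr

lemma inv_exceedProb_sub_one_le {m : ℕ × ℕ} {d y : ℝ} (hd : 0 < d) (hy : d ≤ y)
    (hyd : y + 2 * d ≤ 1) (hm : (y + d) * (m.1 + m.2) ≤ m.1) :
    (exceedProb y m)⁻¹ - 1 ≤ if tailBound d (m.1 + m.2) ≤ 1 / 2 then 2 * tailBound d (m.1 + m.2)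
      else d⁻¹ ^ (m.1 + m.2 + 1) := by
  split_ifs with hsmall
  · have htail : 1 - tailBound d (m.1 + m.2) ≤ exceedProb y m := by
      have hIic : (posterior m).real (Set.Iic y) ≤ tailBound d (m.1 + m.2) := by
        have := posterior_Iic_le (by linarith) hd.le hm
        rw [add_sub_cancel_right] at this
        exact ENNReal.toReal_le_of_le_ofReal (tailBound_nonneg d _) this
      rw [exceedProb, ← Set.compl_Iic, probReal_compl_eq_one_sub measurableSet_Iic]
      linarith
    have hnonneg := tailBound_nonneg d (m.1 + m.2)
    rw [sub_le_iff_le_add, inv_le_comm₀ (by linarith) (by linarith)]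
    refine le_trans ?_ htail
    rw [inv_le_iff_one_le_mul₀ (by linarith)]
    nlinarith
  · calc (exceedProb y m)⁻¹ - 1 ≤ (exceedProb y m)⁻¹ := sub_le_self _ zero_le_one
      _ ≤ (d ^ (m.1 + m.2 + 1))⁻¹ := inv_anti₀ (by positivity) (pow_le_exceedProb hd.le hy hyd m)
      _ = _ := (inv_pow _ _).symm

lemma sum_binomialWeight_mul_inv_exceedProb_le {d y q : ℝ} (hd : 0 < d) (hy : d ≤ y)
    (hyq : y + 3 * d ≤ q) (hq : q ≤ 1) (k : ℕ) :
    ∑ m ∈ antidiagonal k, binomialWeight q (1 - q) m * ((exceedProb y m)⁻¹ - 1) ≤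
      inverseBound d k := by
  set concentrated := if tailBound d k ≤ 1 / 2 then 2 * tailBound d k else d⁻¹ ^ (k + 1)
  have hconcentrated : 0 ≤ concentrated := by
    have := tailBound_nonneg d k
    unfold concentrated
    positivity
  have hpoint : ∀ m ∈ antidiagonal k, binomialWeight q (1 - q) m * ((exceedProb y m)⁻¹ - 1) ≤
      Real.exp (-(k * (d ^ 2 / 2))) / d + binomialWeight q (1 - q) m * concentrated := by
    intro m hm
    have hw : 0 ≤ binomialWeight q (1 - q) m :=
      binomialWeight_nonneg (by linarith) (sub_nonneg.2 hq) m
    obtain rfl := mem_antidiagonal.1 hm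
    rcases le_total (m.1 : ℝ) ((y + d) * (m.1 + m.2)) with hlow | hhigh
    · rw [Nat.cast_add]
      calc binomialWeight q (1 - q) m * ((exceedProb y m)⁻¹ - 1)
          ≤ binomialWeight q (1 - q) m * (exceedProb y m)⁻¹ := by
            gcongr
            exact sub_le_self _ zero_le_one
        _ ≤ _ := (binomialWeight_mul_inv_exceedProb_le hd hy hyq hq hlow).trans
            (le_add_of_nonneg_right (by positivity))
    · calc binomialWeight q (1 - q) m * ((exceedProb y m)⁻¹ - 1)
          ≤ binomialWeight q (1 - q) m * concentrated := by
            gcongr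
            exact inv_exceedProb_sub_one_le hd hy (by linarith) hhigh
        _ ≤ _ := le_add_of_nonneg_left (by positivity)
  refine (sum_le_sum hpoint).trans_eq ?_
  rw [sum_add_distrib, ← sum_mul, sum_antidiagonal_binomialWeight, add_sub_cancel, one_pow,
    one_mul, sum_const, Nat.card_antidiagonal, nsmul_eq_mul, inverseBound, ← mul_div_assoc,
    Nat.cast_add_one]
  rfl

lemma cumulativeCost_inv_exceedProb_sub_one_le {d y q : ℝ} (hd : 0 < d) (hy : d ≤ y)
    (hyq : y + 3 * d ≤ q) (hq : q ≤ 1) (n : ℕ) :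
    cumulativeCost q (1 - q) (fun m => (exceedProb y m)⁻¹ - 1) n 0 ≤ ∑' k, inverseBound d k := by
  simp only [cumulativeCost, zero_add]
  exact (sum_le_sum fun k _ => sum_binomialWeight_mul_inv_exceedProb_le hd hy hyq hq k).trans
    ((summable_inverseBound hd).sum_le_tsum _ fun k _ => inverseBound_nonneg hd k)

/-! ### Exploration -/

/-- The data after which a posterior may fail to be concentrated below a threshold beyond `x`:
fewer than `M` trials, or an empirical mean above `x`. -/
def exploring (M : ℕ) (x : ℝ) : Set (ℕ × ℕ) :=
  {m | m.1 + m.2 < M ∨ x * (m.1 + m.2) < m.1}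

lemma sum_binomialWeight_mul_exploring_le {d q : ℝ} (hd : 0 < d) (hq : 0 ≤ q)
    (hqd : q + d ≤ 1) (M k : ℕ) :
    ∑ m ∈ antidiagonal k, binomialWeight q (1 - q) m * (exploring M (q + d)).indicator 1 m ≤
      (if k < M then 1 else 0) + tailBound d k := by
  have hpoint : ∀ m ∈ antidiagonal k,
      binomialWeight q (1 - q) m * (exploring M (q + d)).indicator 1 m ≤
        binomialWeight q (1 - q) m * (if k < M then 1 else 0) +
          Real.exp (-(k * (d ^ 2 / 2))) := by
    intro m hm
    have hw : 0 ≤ binomialWeight q (1 - q) m := binomialWeight_nonneg hq (by linarith) m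
    obtain rfl := mem_antidiagonal.1 hm
    by_cases hmM : m ∈ exploring M (q + d)
    · rw [Set.indicator_of_mem hmM, Pi.one_apply, mul_one]
      rcases hmM with hfew | hlarge
      · rw [if_pos hfew, mul_one]
        exact le_add_of_nonneg_right (Real.exp_pos _).le
      · refine le_add_of_nonneg_of_le (by positivity) ?_
        have := binomialWeight_le_exp_of_mul_le hq (by linarith) hqd hlarge.le
        rwa [add_sub_cancel_left, ← Nat.cast_add] at this
    · rw [Set.indicator_of_notMem hmM, mul_zero]
      positivity
  refine (sum_le_sum hpoint).trans_eq ?_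
  rw [sum_add_distrib, ← sum_mul, sum_antidiagonal_binomialWeight, add_sub_cancel, one_pow,
    one_mul, sum_const, Nat.card_antidiagonal, nsmul_eq_mul, tailBound]
  push_cast
  rfl

lemma cumulativeCost_exploring_le {d q : ℝ} (hd : 0 < d) (hq : 0 ≤ q)
    (hqd : q + d ≤ 1) (M n : ℕ) :
    cumulativeCost q (1 - q) ((exploring M (q + d)).indicator 1) n 0 ≤
      M + ∑' k, tailBound d k := by
  simp only [cumulativeCost, zero_add]
  refine (sum_le_sum fun k _ => sum_binomialWeight_mul_exploring_le hd hq hqd M k).trans ?_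
  rw [sum_add_distrib]
  refine add_le_add ?_
    ((summable_tailBound hd).sum_le_tsum _ fun k _ => tailBound_nonneg d k)
  rw [sum_boole, Nat.cast_le]
  calc #{k ∈ range n | k < M} ≤ #(range M) :=
        card_le_card fun k hk => mem_range.2 (mem_filter.1 hk).2
    _ = M := card_range M

end BetaPosterior

/-! ### The ranking of the samples -/

section Ranking

variable {L : ℕ}

/-- The files that precede file `i` in the ranking by sampled values, with the tie-breaking rule of
`topC`. -/
def outranking (v : Fin L → ℝ) (i : Fin L) : Finset (Fin L) :=
  {j | v i < v j ∨ (v j = v i ∧ j < i)}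

/-- The `C` most popular files. -/
def popular (C : ℕ) : Finset (Fin L) := {i | (i : ℕ) < C}

lemma mem_popular {C : ℕ} {i : Fin L} : i ∈ popular C ↔ (i : ℕ) < C := mem_filter_univ i

lemma card_popular {C : ℕ} (hCL : C ≤ L) : #(popular C : Finset (Fin L)) = C := by
  rw [popular, Fin.card_filter_val_lt, min_eq_right hCL]

lemma mem_outranking {v : Fin L → ℝ} {i j : Fin L} :
    j ∈ outranking v i ↔ v i < v j ∨ (v j = v i ∧ j < i) := mem_filter_univ j

lemma mem_topC {C : ℕ} {v : Fin L → ℝ} {i : Fin L} : i ∈ topC C v ↔ #(outranking v i) < C :=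
  mem_filter_univ i

lemma notMem_outranking_self (v : Fin L → ℝ) (i : Fin L) : i ∉ outranking v i := by
  simp only [mem_outranking, lt_irrefl, and_false, or_self, not_false_iff]

lemma outranking_ssubset {v : Fin L → ℝ} {i j : Fin L} (h : j ∈ outranking v i) :
    outranking v j ⊂ outranking v i := by
  refine (ssubset_iff_of_subset fun l hl => ?_).2 ⟨j, h, notMem_outranking_self v j⟩
  rw [mem_outranking] at h hl ⊢
  grind

lemma card_outranking_injective (v : Fin L → ℝ) :
    Function.Injective fun i => #(outranking v i) := by
  intro i j hij
  by_contra hne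
  have htotal : j ∈ outranking v i ∨ i ∈ outranking v j := by
    simp only [mem_outranking]
    grind
  rcases htotal with h | h
  · exact (card_lt_card (outranking_ssubset h)).ne' hij
  · exact (card_lt_card (outranking_ssubset h)).ne hij

lemma card_outranking_lt (v : Fin L → ℝ) (i : Fin L) : #(outranking v i) < L :=
  (card_lt_univ_of_notMem (notMem_outranking_self v i)).trans_eq (Fintype.card_fin L)

lemma card_topC {C : ℕ} (hCL : C ≤ L) (v : Fin L → ℝ) : #(topC C v) = C := by
  let rank (i : Fin L) : Fin L := ⟨#(outranking v i), card_outranking_lt v i⟩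
  have hrank : rank.Bijective := Finite.injective_iff_bijective.1 fun i j hij =>
    card_outranking_injective v (Fin.val_eq_of_eq hij)
  calc #(topC C v) = #(popular C : Finset (Fin L)) :=
        card_bijective rank hrank fun i => by rw [mem_topC, mem_popular]
    _ = C := card_popular hCL

lemma topC_sdiff_popular_nonempty_iff {C : ℕ} (hCL : C ≤ L) (v : Fin L → ℝ) :
    (topC C v \ popular C).Nonempty ↔ (popular C \ topC C v).Nonempty := by
  rw [← card_pos, ← card_pos, card_sdiff_comm ((card_topC hCL v).trans (card_popular hCL).symm)]

lemma mem_topC_update_of_lt {C : ℕ} {v : Fin L → ℝ} {i j : Fin L} {z : ℝ} (hj : j ∈ topC C v)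
    (hz : v j < z) : i ∈ topC C (Function.update v i z) := by
  rw [mem_topC] at hj ⊢
  refine (card_le_card fun l hl => ?_).trans_lt hj
  rw [mem_outranking, Function.update_self] at hl
  rw [mem_outranking]
  obtain rfl | hli := eq_or_ne l i
  · simp at hl
  · rw [Function.update_of_ne hli] at hl
    grind

lemma measurableSet_mem_topC (C : ℕ) (i : Fin L) :
    MeasurableSet {v : Fin L → ℝ | i ∈ topC C v} :=
  (measurable_id.prodMk (measurable_const (a := i))) (measurableSet_mem_cache C i)

end Ranking

/-! ### Resampling one coordinate -/

lemma mul_pi_le_compl_mul_pi {ι : Type*} [Fintype ι] [DecidableEq ι] {X : ι → Type*}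
    [∀ i, MeasurableSpace (X i)] (ν : ∀ i, Measure (X i)) [∀ i, SigmaFinite (ν i)]
    {A B : Set (∀ i, X i)} (hA : MeasurableSet A) (hB : MeasurableSet B) (hAB : Disjoint A B)
    {i : ι} {S : Set (X i)} (h : ∀ v ∈ A, ∀ x ∈ S, Function.update v i x ∈ B) :
    ν i S * Measure.pi ν A ≤ ν i Sᶜ * Measure.pi ν B := by
  have hindicator (c : ℝ≥0∞) {E : Set (∀ i, X i)} (hE : MeasurableSet E) :
      c * Measure.pi ν E = ∫⁻ v, E.indicator (fun _ => c) v ∂Measure.pi ν :=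
    (lintegral_indicator_const hE c).symm
  rw [hindicator _ hA, hindicator _ hB]
  refine lintegral_le_of_lmarginal_le {i} (measurable_const.indicator hA)
    (measurable_const.indicator hB) ?_
  rw [lmarginal_singleton, lmarginal_singleton]
  intro v
  have hslice (c : ℝ≥0∞) {E : Set (∀ i, X i)} (hE : MeasurableSet E) :
      ∫⁻ x, E.indicator (fun _ => c) (Function.update v i x) ∂ν i =
        c * ν i (Function.update v i ⁻¹' E) :=
    lintegral_indicator_const (measurable_update v hE) c
  beta_reduce
  rw [hslice _ hA, hslice _ hB]
  obtain hempty | ⟨x, hx⟩ := (Function.update v i ⁻¹' A).eq_empty_or_nonempty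
  · simp only [hempty, measure_empty, mul_zero, zero_le]
  have hS : S ⊆ Function.update v i ⁻¹' B := fun y hy => by
    have hB := h _ hx y hy
    rwa [Function.update_idem] at hB
  rw [mul_comm]
  exact mul_le_mul' (measure_mono fun y hyA hyS => hAB.notMem_of_mem_left hyA (hS hyS))
    (measure_mono hS)

/-! ### One round -/

section Round

variable {L : ℕ}

open Classical in
/-- The success and failure counts after the round `r`, when they were `N` before it. -/
def advance (C : ℕ) (N : Fin L → ℕ × ℕ) (r : Round L) (i : Fin L) : ℕ × ℕ :=
  N i + (if IsSuccess C r i then 1 else 0, if IsFailure C r i then 1 else 0)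

lemma advance_of_notMem {C : ℕ} {N : Fin L → ℕ × ℕ} {r : Round L} {i : Fin L}
    (h : i ∉ cache C r) : advance C N r i = N i := by
  simp only [advance, isSuccess_iff, isFailure_iff, h, false_and, if_false, Prod.mk_zero_zero,
    add_zero]

lemma advance_of_mem {C : ℕ} {N : Fin L → ℕ × ℕ} {r : Round L} {i : Fin L} (h : i ∈ cache C r) :
    advance C N r i = if r.2 = i then N i + (1, 0) else N i + (0, 1) := by
  by_cases hr : r.2 = i <;> simp [advance, isSuccess_iff, isFailure_iff, h, hr]

lemma measurableSet_requested (i : Fin L) : MeasurableSet {r : Round L | r.2 = i} :=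
  measurable_snd (measurableSet_singleton i)

lemma measurable_advance (C : ℕ) (N : Fin L → ℕ × ℕ) (i : Fin L) :
    Measurable fun r : Round L => advance C N r i := by
  have hs : MeasurableSet {r : Round L | IsSuccess C r i} := by
    simp only [isSuccess_iff]
    exact (measurableSet_mem_cache C i).inter (measurableSet_requested i)
  have hf : MeasurableSet {r : Round L | IsFailure C r i} := by
    simp only [isFailure_iff]
    exact (measurableSet_mem_cache C i).inter (measurableSet_requested i).compl
  exact measurable_const.add ((measurable_const.ite hs measurable_const).prodMk
    (measurable_const.ite hf measurable_const))

lemma roundKernel_fst_preimage (μ : PMF (Fin L)) (N : Fin L → ℕ × ℕ) {S : Set (Fin L → ℝ)}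
    (hS : MeasurableSet S) : roundKernel μ N (Prod.fst ⁻¹' S) = samplingLaw N S := by
  change (samplingLaw N).prod μ.toMeasure (Prod.fst ⁻¹' S) = _
  rw [← Measure.map_apply measurable_fst hS, Measure.map_fst_prod, measure_univ, one_smul]

lemma lintegral_toMeasure_ite_eq {α : Type*} [MeasurableSpace α] [MeasurableSingletonClass α]
    [DecidableEq α] (μ : PMF α) (a : α) (s t : ℝ≥0∞) :
    ∫⁻ x, (if x = a then s else t) ∂μ.toMeasure = μ a * s + (1 - μ a) * t := by
  have h := lintegral_piecewise (μ := μ.toMeasure) (measurableSet_singleton a) (fun _ => s)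
    fun _ => t
  rw [setLIntegral_const, setLIntegral_const, prob_compl_eq_one_sub (measurableSet_singleton a),
    μ.toMeasure_apply_singleton a (measurableSet_singleton a), mul_comm s, mul_comm t] at h
  rw [← h]
  rfl

lemma cost_add_lintegral_cumulativeCost_le (μ : PMF (Fin L)) (C : ℕ) (N : Fin L → ℕ × ℕ)
    (i : Fin L) (φ : ℕ × ℕ → ℝ≥0∞) (n : ℕ) :
    φ (N i) * samplingLaw N {v | i ∈ topC C v} +
        ∫⁻ r, cumulativeCost (μ i) (1 - μ i) φ n (advance C N r i) ∂roundKernel μ N ≤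
      cumulativeCost (μ i) (1 - μ i) φ (n + 1) (N i) := by
  set V := cumulativeCost (μ i) (1 - μ i) φ n
  have hV : Measurable fun r => V (advance C N r i) :=
    (measurable_of_countable V).comp (measurable_advance C N i)
  have hcached := measurableSet_mem_topC C i
  have hpoint (v : Fin L → ℝ) : {v | i ∈ topC C v}.indicator (fun _ => φ (N i)) v +
      ∫⁻ x, V (advance C N (v, x) i) ∂μ.toMeasure ≤
        cumulativeCost (μ i) (1 - μ i) φ (n + 1) (N i) := by
    by_cases hv : i ∈ topC C v
    · have hmem (x : Fin L) : i ∈ cache C (v, x) := hv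
      simp only [Set.indicator_apply, Set.mem_ofPred_eq, hv, if_true, advance_of_mem (hmem _),
        apply_ite V]
      rw [lintegral_toMeasure_ite_eq, cumulativeCost_succ]
    · have hnotMem (x : Fin L) : i ∉ cache C (v, x) := hv
      simp only [Set.indicator_apply, Set.mem_ofPred_eq, hv, if_false, zero_add,
        advance_of_notMem (hnotMem _)]
      rw [lintegral_const, measure_univ, mul_one]
      exact cumulativeCost_le_succ _ _ φ n (N i)
  rw [← lintegral_indicator_const hcached]
  change _ + ∫⁻ r, _ ∂(samplingLaw N).prod μ.toMeasure ≤ _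
  rw [lintegral_prod _ hV.aemeasurable, ← lintegral_add_left (measurable_const.indicator hcached)]
  refine (lintegral_mono hpoint).trans_eq ?_
  rw [lintegral_const, measure_univ, mul_one]

end Round

/-! ### The process -/

section Run

variable {L : ℕ}

open Classical in
/-- The success and failure counts before round `t`. -/
def countsBefore (C t : ℕ) (ω : ℕ → Round L) (i : Fin L) : ℕ × ℕ :=
  (∑ s ∈ range t, if IsSuccess C (ω s) i then 1 else 0,
    ∑ s ∈ range t, if IsFailure C (ω s) i then 1 else 0)

lemma countsBefore_zero (C : ℕ) (ω : ℕ → Round L) : countsBefore C 0 ω = fun _ => (0, 0) := rfl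

lemma countsBefore_succ (C t : ℕ) (ω : ℕ → Round L) :
    countsBefore C (t + 1) ω = advance C (countsBefore C t ω) (ω t) := by
  funext i
  rw [advance, countsBefore, countsBefore, sum_range_succ, sum_range_succ, Prod.mk_add_mk]

lemma countsBefore_succ_eq_counts (C n : ℕ) (ω : ℕ → Round L) :
    countsBefore C (n + 1) ω = counts C n (Preorder.frestrictLe n ω) := by
  classical
  funext i
  rw [countsBefore, counts, Nat.range_succ_eq_Iic]
  congr 1
  · exact (sum_coe_sort (Iic n) fun s => if IsSuccess C (ω s) i then 1 else 0).symm
  · exact (sum_coe_sort (Iic n) fun s => if IsFailure C (ω s) i then 1 else 0).symm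

lemma measurable_countsBefore (C t : ℕ) :
    Measurable (countsBefore C t : (ℕ → Round L) → Fin L → ℕ × ℕ) := by
  cases t with
  | zero =>
    rw [funext (countsBefore_zero C)]
    exact measurable_const
  | succ n =>
    rw [funext (countsBefore_succ_eq_counts C n)]
    exact (measurable_counts C n).comp (Preorder.measurable_frestrictLe n)

instance (μ : PMF (Fin L)) (C : ℕ) : IsProbabilityMeasure (mpsLaw μ C) := by
  unfold mpsLaw
  infer_instance

lemma map_eval_zero_mpsLaw (μ : PMF (Fin L)) (C : ℕ) :
    (mpsLaw μ C).map (fun ω => ω 0) = roundKernel μ fun _ => (0, 0) := by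
  have heval : (fun ω : ℕ → Round L => ω 0) =
      (fun h : Finset.Iic 0 → Round L => h ⟨0, by simp⟩) ∘ Preorder.frestrictLe 0 := rfl
  rw [heval, ← Measure.map_map (by fun_prop) (by fun_prop), mpsLaw, Kernel.trajMeasure,
    Measure.map_comp _ _ (by fun_prop), Kernel.traj_map_frestrictLe, Kernel.partialTraj_self,
    Measure.id_comp, Measure.map_map (by fun_prop) (by fun_prop)]
  exact Measure.map_id

lemma lintegral_mpsLaw_round (μ : PMF (Fin L)) (C t : ℕ)
    {f : (Fin L → ℕ × ℕ) → Round L → ℝ≥0∞} (hf : ∀ N, Measurable (f N)) :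
    ∫⁻ ω, f (countsBefore C t ω) (ω t) ∂mpsLaw μ C =
      ∫⁻ ω, ∫⁻ r, f (countsBefore C t ω) r ∂roundKernel μ (countsBefore C t ω) ∂mpsLaw μ C := by
  cases t with
  | zero =>
    simp only [countsBefore_zero, lintegral_const, measure_univ, mul_one]
    rw [← map_eval_zero_mpsLaw μ C, lintegral_map (hf _) (measurable_pi_apply 0)]
  | succ n =>
    simp only [countsBefore_succ_eq_counts]
    have hF : Measurable (Function.uncurry f) := measurable_from_prod_countable_right hf
    have hG : Measurable fun p : (Finset.Iic n → Round L) × Round L => f (counts C n p.1) p.2 :=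
      hF.comp (((measurable_counts C n).comp measurable_fst).prodMk measurable_snd)
    have hlaw := Kernel.map_frestrictLe_trajMeasure_compProd_eq_map_trajMeasure
      (X := fun _ => Round L) (μ₀ := roundKernel μ fun _ => (0, 0)) (κ := nextRound μ C) (a := n)
    have hpair := lintegral_map (μ := mpsLaw μ C) hG
      (g := fun ω => (Preorder.frestrictLe (π := fun _ => Round L) n ω, ω (n + 1))) (by fun_prop)
    rw [mpsLaw, ← hlaw, Measure.lintegral_compProd hG, lintegral_map
      hG.lintegral_kernel_prod_right' (by fun_prop)] at hpair
    exact hpair.symm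

lemma mpsLaw_samples_mem (μ : PMF (Fin L)) (C t : ℕ) {S : Set (Fin L → ℝ)}
    (hS : MeasurableSet S) :
    mpsLaw μ C {ω | (ω t).1 ∈ S} = ∫⁻ ω, samplingLaw (countsBefore C t ω) S ∂mpsLaw μ C := by
  have hE : MeasurableSet (Prod.fst ⁻¹' S : Set (Round L)) := measurable_fst hS
  have h := lintegral_mpsLaw_round μ C t (f := fun _ => (Prod.fst ⁻¹' S).indicator 1)
    fun _ => measurable_one.indicator hE
  simp only [lintegral_indicator_one hE, roundKernel_fst_preimage μ _ hS] at h
  rw [← h]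
  exact (lintegral_indicator_one (measurable_pi_apply (X := fun _ => Round L) t hE)).symm

/-! ### Charging the rounds in which a file is cached -/

/-- The expected total of the costs `φ (m)`, charged in the rounds `t < T` in which file `i` is
cached, where `m` are its counts before the round. -/
def chargedCost (μ : PMF (Fin L)) (C : ℕ) (i : Fin L) (φ : ℕ × ℕ → ℝ≥0∞) (T : ℕ) : ℝ≥0∞ :=
  ∑ t ∈ range T, ∫⁻ ω, φ (countsBefore C t ω i) *
    samplingLaw (countsBefore C t ω) {v | i ∈ topC C v} ∂mpsLaw μ C

lemma chargedCost_add_lintegral_cumulativeCost_le (μ : PMF (Fin L)) (C : ℕ) (i : Fin L)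
    (φ : ℕ × ℕ → ℝ≥0∞) (t n : ℕ) :
    chargedCost μ C i φ t +
        ∫⁻ ω, cumulativeCost (μ i) (1 - μ i) φ n (countsBefore C t ω i) ∂mpsLaw μ C ≤
      cumulativeCost (μ i) (1 - μ i) φ (t + n) 0 := by
  induction t generalizing n with
  | zero => simp [chargedCost, countsBefore_zero, Prod.mk_zero_zero]
  | succ t ih =>
    have hV (n : ℕ) : Measurable (cumulativeCost (μ i) (1 - μ i) φ n) := measurable_of_countable _
    have hcost : Measurable fun ω : ℕ → Round L => φ (countsBefore C t ω i) *
        samplingLaw (countsBefore C t ω) {v | i ∈ topC C v} :=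
      (measurable_of_countable fun N : Fin L → ℕ × ℕ =>
        φ (N i) * samplingLaw N {v | i ∈ topC C v}).comp (measurable_countsBefore C t)
    have hround := lintegral_mpsLaw_round μ C t
      (f := fun N r => cumulativeCost (μ i) (1 - μ i) φ n (advance C N r i))
      fun N => (hV n).comp (measurable_advance C N i)
    simp only [countsBefore_succ]
    rw [hround, chargedCost, sum_range_succ, add_assoc, ← lintegral_add_left hcost,
      add_assoc t, add_comm 1 n]
    refine le_trans ?_ (ih (n + 1))
    gcongr with ω
    · rfl
    · exact cost_add_lintegral_cumulativeCost_le μ C _ i φ n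

lemma toReal_apply_le_one {α : Type*} (μ : PMF α) (a : α) : (μ a).toReal ≤ 1 :=
  ENNReal.toReal_le_of_le_ofReal zero_le_one ((μ.coe_le_one a).trans_eq ENNReal.ofReal_one.symm)

lemma chargedCost_ofReal_le (μ : PMF (Fin L)) (C : ℕ) (i : Fin L) {ψ : ℕ × ℕ → ℝ}
    (hψ : ∀ m, 0 ≤ ψ m) (T : ℕ) :
    chargedCost μ C i (fun m => ENNReal.ofReal (ψ m)) T ≤
      ENNReal.ofReal (cumulativeCost (μ i).toReal (1 - (μ i).toReal) ψ T 0) := by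
  rw [ofReal_cumulativeCost ENNReal.toReal_nonneg (sub_nonneg.2 (toReal_apply_le_one μ i)) hψ,
    ENNReal.ofReal_sub _ ENNReal.toReal_nonneg, ENNReal.ofReal_toReal (μ.apply_ne_top i),
    ENNReal.ofReal_one]
  exact le_self_add.trans (chargedCost_add_lintegral_cumulativeCost_le μ C i _ T 0)

/-! ### Displaced popular files -/

lemma le_ofReal_inv_sub_one_mul {α : Type*} [MeasurableSpace α] {ν : Measure α}
    [IsProbabilityMeasure ν] {S : Set α} (hS : MeasurableSet S) (hpos : 0 < ν.real S)
    {s t : ℝ≥0∞} (h : ν S * s ≤ ν Sᶜ * t) : s ≤ ENNReal.ofReal ((ν.real S)⁻¹ - 1) * t := by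
  have hS0 : ν S ≠ 0 := fun h0 => hpos.ne' (by rw [measureReal_def, h0, ENNReal.toReal_zero])
  have hodds : ENNReal.ofReal ((ν.real S)⁻¹ - 1) = (ν S)⁻¹ * ν Sᶜ := by
    rw [← ofReal_measureReal (μ := ν) (s := S), ← ofReal_measureReal (μ := ν) (s := Sᶜ),
      ← ENNReal.ofReal_inv_of_pos hpos, ← ENNReal.ofReal_mul (inv_nonneg.2 hpos.le),
      probReal_compl_eq_one_sub hS, mul_sub, mul_one, inv_mul_cancel₀ hpos.ne']
  calc s = (ν S)⁻¹ * (ν S * s) := by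
        rw [← mul_assoc, ENNReal.inv_mul_cancel hS0 (measure_ne_top ν S), one_mul]
    _ ≤ (ν S)⁻¹ * (ν Sᶜ * t) := by gcongr
    _ = _ := by rw [hodds, mul_assoc]

/-- The samples for which file `j` is cached on account of a value at most `y` while file `i` is
not cached. -/
def displaced (C : ℕ) (i j : Fin L) (y : ℝ) : Set (Fin L → ℝ) :=
  {v | j ∈ topC C v ∧ v j ≤ y ∧ i ∉ topC C v}

lemma measurableSet_displaced (C : ℕ) (i j : Fin L) (y : ℝ) :
    MeasurableSet (displaced C i j y) :=
  (measurableSet_mem_topC C j).inter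
    ((measurableSet_le (measurable_pi_apply j) measurable_const).inter
      (measurableSet_mem_topC C i).compl)

lemma samplingLaw_displaced_le (C : ℕ) (N : Fin L → ℕ × ℕ) (i j : Fin L) {y : ℝ}
    (hpos : 0 < exceedProb y (N i)) :
    samplingLaw N (displaced C i j y) ≤
      ENNReal.ofReal ((exceedProb y (N i))⁻¹ - 1) * samplingLaw N {v | i ∈ topC C v} :=
  le_ofReal_inv_sub_one_mul measurableSet_Ioi hpos <|
    mul_pi_le_compl_mul_pi (fun l => posterior (N l)) (measurableSet_displaced C i j y)
      (measurableSet_mem_topC C i) (Set.disjoint_left.2 fun _ hv => hv.2.2)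
      fun _ hv _ hxy => mem_topC_update_of_lt hv.1 (hv.2.1.trans_lt hxy)

lemma sum_mpsLaw_displaced_le (μ : PMF (Fin L)) (C : ℕ) (i j : Fin L) {d y : ℝ} (hd : 0 < d)
    (hy : d ≤ y) (hyi : y + 3 * d ≤ (μ i).toReal) (T : ℕ) :
    ∑ t ∈ range T, mpsLaw μ C {ω | (ω t).1 ∈ displaced C i j y} ≤
      ENNReal.ofReal (∑' k, inverseBound d k) := by
  have hi := toReal_apply_le_one μ i
  have hpos (m : ℕ × ℕ) : 0 < exceedProb y m := exceedProb_pos hd hy (by linarith) m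
  calc ∑ t ∈ range T, mpsLaw μ C {ω | (ω t).1 ∈ displaced C i j y}
      ≤ chargedCost μ C i (fun m => ENNReal.ofReal ((exceedProb y m)⁻¹ - 1)) T :=
        sum_le_sum fun t _ => (mpsLaw_samples_mem μ C t (measurableSet_displaced C i j y)).trans_le
          (lintegral_mono fun ω => samplingLaw_displaced_le C _ i j (hpos _))
    _ ≤ _ := chargedCost_ofReal_le μ C i
        (fun m => sub_nonneg.2 ((one_le_inv₀ (hpos m)).2 (exceedProb_le_one y m))) T
    _ ≤ _ := ENNReal.ofReal_le_ofReal
        (cumulativeCost_inv_exceedProb_sub_one_le hd hy hyi hi T)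

/-! ### Inflated samples -/

/-- The samples for which file `j` is cached on account of a value above `y`. -/
def inflated (C : ℕ) (j : Fin L) (y : ℝ) : Set (Fin L → ℝ) :=
  {v | j ∈ topC C v ∧ y < v j}

lemma measurableSet_inflated (C : ℕ) (j : Fin L) (y : ℝ) : MeasurableSet (inflated C j y) :=
  (measurableSet_mem_topC C j).inter (measurableSet_lt measurable_const (measurable_pi_apply j))

lemma samplingLaw_eval_preimage (N : Fin L → ℕ × ℕ) (j : Fin L) {S : Set ℝ}
    (hS : MeasurableSet S) : samplingLaw N {v | v j ∈ S} = posterior (N j) S :=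
  (measurePreserving_eval (fun i => posterior (N i)) j).measure_preimage hS.nullMeasurableSet

lemma samplingLaw_inflated_le (C : ℕ) (N : Fin L → ℕ × ℕ) (j : Fin L) {d s x : ℝ} (hd : 0 < d)
    (hs : 0 < s) (hx : 0 ≤ x) {M : ℕ} (hM : 4 / d ^ 2 * Real.log s ≤ M) :
    samplingLaw N (inflated C j (x + d)) ≤
      ENNReal.ofReal ((exploring M x).indicator 1 (N j)) * samplingLaw N {v | j ∈ topC C v} +
        ENNReal.ofReal ((4 / d ^ 2 + 1) / s) := by
  by_cases hN : N j ∈ exploring M x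
  · refine le_add_right ?_
    rw [Set.indicator_of_mem hN, Pi.one_apply, ENNReal.ofReal_one, one_mul]
    exact measure_mono fun v hv => hv.1
  · refine le_add_left ?_
    obtain ⟨hM', hx'⟩ : M ≤ (N j).1 + (N j).2 ∧ (N j).1 ≤ x * ((N j).1 + (N j).2) := by
      simpa only [exploring, Set.mem_ofPred_eq, not_or, not_lt] using hN
    calc samplingLaw N (inflated C j (x + d))
        ≤ samplingLaw N {v | v j ∈ Set.Ioi (x + d)} := measure_mono fun v hv => hv.2
      _ = posterior (N j) (Set.Ioi (x + d)) := samplingLaw_eval_preimage N j measurableSet_Ioi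
      _ ≤ ENNReal.ofReal (tailBound d ((N j).1 + (N j).2)) := posterior_Ioi_le hx hd.le hx'
      _ ≤ _ := ENNReal.ofReal_le_ofReal
          (tailBound_le_of_log_le hd hs (hM.trans (by exact_mod_cast hM')))

lemma sum_mpsLaw_inflated_le (μ : PMF (Fin L)) (C : ℕ) (j : Fin L) {d : ℝ} (hd : 0 < d)
    (hj : (μ j).toReal + d ≤ 1) {T M : ℕ} (hT : 0 < T) (hM : 4 / d ^ 2 * Real.log T ≤ M) :
    ∑ t ∈ range T, mpsLaw μ C {ω | (ω t).1 ∈ inflated C j ((μ j).toReal + d + d)} ≤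
      ENNReal.ofReal (M + ∑' k, tailBound d k + (4 / d ^ 2 + 1)) := by
  have hj0 : 0 ≤ (μ j).toReal := ENNReal.toReal_nonneg
  have hT0 : (0 : ℝ) < T := by exact_mod_cast hT
  set x := (μ j).toReal + d
  have hx0 : 0 ≤ x := by positivity
  set c := (4 / d ^ 2 + 1) / T with hc
  have hround (t : ℕ) : mpsLaw μ C {ω | (ω t).1 ∈ inflated C j (x + d)} ≤
      ∫⁻ ω, ENNReal.ofReal ((exploring M x).indicator 1 (countsBefore C t ω j)) *
        samplingLaw (countsBefore C t ω) {v | j ∈ topC C v} ∂mpsLaw μ C + ENNReal.ofReal c := by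
    rw [mpsLaw_samples_mem μ C t (measurableSet_inflated C j (x + d))]
    refine (lintegral_mono fun ω => samplingLaw_inflated_le C _ j hd hT0 hx0 hM).trans_eq ?_
    rw [lintegral_add_right _ measurable_const, lintegral_const, measure_univ, mul_one]
  have hbound : 0 ≤ M + ∑' k, tailBound d k :=
    add_nonneg M.cast_nonneg (tsum_nonneg (tailBound_nonneg d))
  calc ∑ t ∈ range T, mpsLaw μ C {ω | (ω t).1 ∈ inflated C j (x + d)}
      ≤ chargedCost μ C j (fun m => ENNReal.ofReal ((exploring M x).indicator 1 m)) T +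
          T * ENNReal.ofReal c := by
        refine (sum_le_sum fun t _ => hround t).trans_eq ?_
        rw [sum_add_distrib, sum_const, card_range, nsmul_eq_mul, chargedCost]
    _ ≤ ENNReal.ofReal (M + ∑' k, tailBound d k) + ENNReal.ofReal (4 / d ^ 2 + 1) := by
        gcongr
        · exact (chargedCost_ofReal_le μ C j
            (Set.indicator_nonneg fun _ _ => zero_le_one) T).trans (ENNReal.ofReal_le_ofReal
              (cumulativeCost_exploring_le hd hj0 hj M T))
        · rw [← ENNReal.ofReal_natCast, ← ENNReal.ofReal_mul hT0.le, hc, mul_div_cancel₀ _ hT0.ne']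
    _ = _ := (ENNReal.ofReal_add hbound (by positivity)).symm

/-! ### Regret -/

lemma sum_mpsLaw_mem_topC_le (μ : PMF (Fin L)) {C : ℕ} (hCL : C ≤ L) {j : Fin L}
    (hj : j ∉ popular C) {d : ℝ} (hd : 0 < d)
    (hgap : ∀ i ∈ popular C, (μ j).toReal + 5 * d ≤ (μ i).toReal) (hj1 : (μ j).toReal + d ≤ 1)
    {T M : ℕ} (hT : 0 < T) (hM : 4 / d ^ 2 * Real.log T ≤ M) :
    ∑ t ∈ range T, mpsLaw μ C {ω | j ∈ topC C (ω t).1} ≤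
      ENNReal.ofReal (M + ∑' k, tailBound d k + (4 / d ^ 2 + 1) + C * ∑' k, inverseBound d k) := by
  have hinverse : 0 ≤ ∑' k, inverseBound d k := tsum_nonneg (inverseBound_nonneg hd)
  have htail : 0 ≤ ∑' k, tailBound d k := tsum_nonneg (tailBound_nonneg d)
  have hj0 : 0 ≤ (μ j).toReal := ENNReal.toReal_nonneg
  set y := (μ j).toReal + d + d
  have hround (t : ℕ) : mpsLaw μ C {ω | j ∈ topC C (ω t).1} ≤
      mpsLaw μ C {ω | (ω t).1 ∈ inflated C j y} +
        ∑ i ∈ popular C, mpsLaw μ C {ω | (ω t).1 ∈ displaced C i j y} := by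
    have hcover : {ω | j ∈ topC C (ω t).1} ⊆ {ω : ℕ → Round L | (ω t).1 ∈ inflated C j y} ∪
        ⋃ i ∈ popular C, {ω | (ω t).1 ∈ displaced C i j y} := by
      intro ω hω
      rcases lt_or_ge y ((ω t).1 j) with hlt | hle
      · exact Or.inl ⟨hω, hlt⟩
      · obtain ⟨i, hi⟩ := (topC_sdiff_popular_nonempty_iff hCL (ω t).1).1
          ⟨j, mem_sdiff.2 ⟨hω, hj⟩⟩
        rw [mem_sdiff] at hi
        exact Or.inr (Set.mem_biUnion hi.1 ⟨hω, hle, hi.2⟩)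
    exact (measure_mono hcover).trans ((measure_union_le _ _).trans
      (by gcongr; exact measure_biUnion_finset_le _ _))
  calc ∑ t ∈ range T, mpsLaw μ C {ω | j ∈ topC C (ω t).1}
      ≤ ∑ t ∈ range T, mpsLaw μ C {ω | (ω t).1 ∈ inflated C j y} + ∑ i ∈ popular C,
          ∑ t ∈ range T, mpsLaw μ C {ω | (ω t).1 ∈ displaced C i j y} := by
        rw [sum_comm (s := popular C), ← sum_add_distrib]
        exact sum_le_sum fun t _ => hround t
    _ ≤ ENNReal.ofReal (M + ∑' k, tailBound d k + (4 / d ^ 2 + 1)) +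
          ∑ _i ∈ (popular C : Finset (Fin L)), ENNReal.ofReal (∑' k, inverseBound d k) := by
        refine add_le_add (sum_mpsLaw_inflated_le μ C j hd hj1 hT hM) (sum_le_sum fun i hi => ?_)
        exact sum_mpsLaw_displaced_le μ C i j hd (by linarith) (by linarith [hgap i hi]) T
    _ = _ := by
        rw [sum_const, card_popular hCL, nsmul_eq_mul, ← ENNReal.ofReal_natCast,
          ← ENNReal.ofReal_mul C.cast_nonneg, ← ENNReal.ofReal_add (by positivity) (by positivity)]

lemma regret_le {C : ℕ} (hCL : C ≤ L) (T : ℕ) (ω : ℕ → Round L) :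
    regret C T ω ≤ ∑ t ∈ range T, ∑ j ∈ (popular C)ᶜ,
      {ω : ℕ → Round L | j ∈ topC C (ω t).1}.indicator 1 ω := by
  refine sum_le_sum fun t _ => ?_
  have hnonneg (j : Fin L) : (0 : ℝ) ≤ {ω : ℕ → Round L | j ∈ topC C (ω t).1}.indicator 1 ω :=
    Set.indicator_nonneg (fun _ _ => zero_le_one) _
  by_cases hmiss : ((ω t).2 : ℕ) < C ∧ (ω t).2 ∉ cache C (ω t)
  · obtain ⟨j, hj⟩ := (topC_sdiff_popular_nonempty_iff hCL (ω t).1).2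
      ⟨(ω t).2, mem_sdiff.2 ⟨mem_popular.2 hmiss.1, hmiss.2⟩⟩
    rw [mem_sdiff] at hj
    have hone : {ω : ℕ → Round L | j ∈ topC C (ω t).1}.indicator (1 : (ℕ → Round L) → ℝ) ω = 1 :=
      Set.indicator_of_mem (s := {ω : ℕ → Round L | j ∈ topC C (ω t).1}) hj.1 1
    rw [if_pos hmiss.1, if_neg hmiss.2, sub_zero, ← hone]
    exact single_le_sum (fun j _ => hnonneg j) (mem_compl.2 hj.2)
  · refine le_trans ?_ (sum_nonneg fun j _ => hnonneg j)
    split_ifs <;> first | (norm_num; done) | tauto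

lemma measurableSet_hit (C : ℕ) : MeasurableSet {r : Round L | r.2 ∈ cache C r} := by
  have hunion : {r : Round L | r.2 ∈ cache C r} = ⋃ i, {r | i ∈ cache C r} ∩ {r | r.2 = i} := by
    ext r
    simp
  rw [hunion]
  exact MeasurableSet.iUnion fun i =>
    (measurableSet_mem_cache C i).inter (measurableSet_requested i)

lemma integrable_regret (μ : PMF (Fin L)) (C T : ℕ) : Integrable (regret C T) (mpsLaw μ C) := by
  have hpopular : MeasurableSet {r : Round L | (r.2 : ℕ) < C} :=
    measurable_snd (Set.toFinite {x : Fin L | (x : ℕ) < C}).measurableSet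
  have hite (t : ℕ) {p : Round L → Prop} [DecidablePred p] (hp : MeasurableSet {r | p r}) :
      Integrable (fun ω => if p (ω t) then (1 : ℝ) else 0) (mpsLaw μ C) := by
    have hmeas : Measurable fun r => if p r then (1 : ℝ) else 0 :=
      measurable_const.ite hp measurable_const
    exact .of_bound (hmeas.comp (measurable_pi_apply t)).aestronglyMeasurable 1
      (.of_forall fun ω => by split_ifs <;> simp)
  unfold regret
  exact integrable_finsetSum _ fun t _ =>
    (hite t (p := fun r => (r.2 : ℕ) < C) hpopular).sub
      (hite t (p := fun r => r.2 ∈ cache C r) (measurableSet_hit C))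

lemma integral_regret_le (μ : PMF (Fin L)) {C : ℕ} (hCL : C ≤ L) (T : ℕ) {B : ℝ} (hB : 0 ≤ B)
    (h : ∀ j ∉ popular C,
      ∑ t ∈ range T, mpsLaw μ C {ω | j ∈ topC C (ω t).1} ≤ ENNReal.ofReal B) :
    ∫ ω, regret C T ω ∂mpsLaw μ C ≤ (L - C) * B := by
  have hmeas (t : ℕ) (j : Fin L) : MeasurableSet {ω : ℕ → Round L | j ∈ topC C (ω t).1} :=
    measurable_fst.comp (measurable_pi_apply (X := fun _ => Round L) t)
      (measurableSet_mem_topC C j)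
  have hint (t : ℕ) (j : Fin L) : Integrable
      ({ω : ℕ → Round L | j ∈ topC C (ω t).1}.indicator (1 : (ℕ → Round L) → ℝ)) (mpsLaw μ C) :=
    (integrable_const (1 : ℝ)).indicator (hmeas t j)
  have hint' (t : ℕ) := integrable_finsetSum (popular C)ᶜ fun j _ => hint t j
  calc ∫ ω, regret C T ω ∂mpsLaw μ C
      ≤ ∫ ω, ∑ t ∈ range T, ∑ j ∈ (popular C)ᶜ,
          {ω : ℕ → Round L | j ∈ topC C (ω t).1}.indicator 1 ω ∂mpsLaw μ C :=
        integral_mono (integrable_regret μ C T) (integrable_finsetSum _ fun t _ => hint' t)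
          (regret_le hCL T)
    _ = ∑ j ∈ (popular C)ᶜ, ∑ t ∈ range T, (mpsLaw μ C).real {ω | j ∈ topC C (ω t).1} := by
        rw [integral_finsetSum _ fun t _ => hint' t, sum_comm]
        refine sum_congr rfl fun t _ => ?_
        rw [integral_finsetSum _ fun j _ => hint t j]
        exact sum_congr rfl fun j _ => integral_indicator_one (hmeas t j)
    _ ≤ ∑ _j ∈ (popular C : Finset (Fin L))ᶜ, B := by
        refine sum_le_sum fun j hj => ?_
        have hj := ENNReal.toReal_le_of_le_ofReal hB (h j (mem_compl.1 hj))
        rwa [ENNReal.toReal_sum fun t _ => measure_ne_top _ _] at hj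
    _ = (L - C) * B := by
        rw [sum_const, card_compl, Fintype.card_fin, card_popular hCL, nsmul_eq_mul,
          Nat.cast_sub hCL]

/-- The constant in the regret bound, as a function of a fifth of the gap. -/
def regretConst (d : ℝ) : ℝ :=
  4 / d ^ 2 + (2 + ∑' k, tailBound d k + 4 / d ^ 2 + ∑' k, inverseBound d k) / Real.log 2

lemma regretConst_nonneg {d : ℝ} (hd : 0 < d) : 0 ≤ regretConst d := by
  have htail : 0 ≤ ∑' k, tailBound d k := tsum_nonneg (tailBound_nonneg d)
  have hinverse : 0 ≤ ∑' k, inverseBound d k := tsum_nonneg (inverseBound_nonneg hd)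
  unfold regretConst
  positivity

lemma add_tsum_le_regretConst_mul {d : ℝ} (hd : 0 < d) {C T M : ℕ} (hC : 0 < C) (hT : 2 ≤ T)
    (hM : M ≤ 4 / d ^ 2 * Real.log T + 1) :
    M + ∑' k, tailBound d k + (4 / d ^ 2 + 1) + C * ∑' k, inverseBound d k ≤
      regretConst d * (C * Real.log T) := by
  have hB : 0 ≤ ∑' k, inverseBound d k := tsum_nonneg (inverseBound_nonneg hd)
  have hA : 0 ≤ ∑' k, tailBound d k := tsum_nonneg (tailBound_nonneg d)
  unfold regretConst
  set A := ∑' k, tailBound d k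
  set B := ∑' k, inverseBound d k
  set r := 4 / d ^ 2
  have hr : 0 ≤ r := by positivity
  have hC1 : (1 : ℝ) ≤ C := by exact_mod_cast hC
  have hlog2 : 0 < Real.log 2 := Real.log_pos one_lt_two
  have hlog : Real.log 2 ≤ Real.log T := Real.log_le_log two_pos (by exact_mod_cast hT)
  have habsorb : 2 + A + r + B ≤ (2 + A + r + B) / Real.log 2 * Real.log T := by
    rw [div_mul_eq_mul_div, le_div_iff₀ hlog2]
    gcongr
  calc M + A + (r + 1) + C * B ≤ r * Real.log T + 1 + A + (r + 1) + C * B := by gcongr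
    _ ≤ C * (r * Real.log T) + C * (2 + A + r + B) := by
        have : 0 ≤ r * Real.log T := mul_nonneg hr (hlog2.le.trans hlog)
        nlinarith
    _ ≤ C * (r * Real.log T) + C * ((2 + A + r + B) / Real.log 2 * Real.log T) := by gcongr
    _ = _ := by ring

end Run

/-! ### The gap -/

lemma gap_pos {L C : ℕ} (hC : 0 < C) (hCL : C < L) {μ : PMF (Fin L)} (hμ : StrictAnti μ) :
    0 < gap μ C hCL :=
  sub_pos.2 (ENNReal.toReal_strict_mono (μ.apply_ne_top _)
    (hμ (Fin.mk_lt_mk.2 (Nat.sub_lt hC one_pos))))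

lemma toReal_add_gap_le {L C : ℕ} (hCL : C < L) {μ : PMF (Fin L)} (hμ : Antitone μ) {i j : Fin L}
    (hi : (i : ℕ) < C) (hj : C ≤ (j : ℕ)) : (μ j).toReal + gap μ C hCL ≤ (μ i).toReal := by
  have hantitone {k l : Fin L} (hkl : k ≤ l) : (μ l).toReal ≤ (μ k).toReal :=
    ENNReal.toReal_mono (μ.apply_ne_top k) (hμ hkl)
  have hji : (μ j).toReal ≤ (μ ⟨C, hCL⟩).toReal := hantitone hj
  have hlast : (μ ⟨C - 1, by omega⟩).toReal ≤ (μ i).toReal := hantitone (Nat.le_sub_one_of_lt hi)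
  unfold gap
  linarith

end Caching

end

theorem mainTheorem5_general :
    ∃ K : ℝ → ℝ, ∀ (L C : ℕ) (_hC : 0 < C) (_hCL : C ≤ L) (μ : PMF (Fin L)) (g : ℝ) (_hg : 0 < g)
      (_hμ : ∀ i j : Fin L, (i : ℕ) < C → C ≤ (j : ℕ) → (μ j).toReal + g ≤ (μ i).toReal)
      (T : ℕ) (_hT : 2 ≤ T),
      MeasureTheory.Integrable (Caching.regret C T) (Caching.mpsLaw μ C) ∧
      ∫ ω, Caching.regret C T ω ∂(Caching.mpsLaw μ C) ≤
        K g * (((L : ℝ) - C) * C * Real.log T) := by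
  refine ⟨fun g => Caching.regretConst (g / 5), fun L C hC hCL μ g hg hμ T hT =>
    ⟨Caching.integrable_regret μ C T, ?_⟩⟩
  have hd : 0 < g / 5 := by positivity
  set M := ⌈4 / (g / 5) ^ 2 * Real.log T⌉₊
  have hrate := Caching.add_tsum_le_regretConst_mul hd hC hT (M := M)
    (Nat.ceil_lt_add_one (by positivity)).le
  have hbound : 0 ≤ Caching.regretConst (g / 5) * (C * Real.log T) :=
    mul_nonneg (Caching.regretConst_nonneg hd) (by positivity)
  refine (Caching.integral_regret_le μ hCL T hbound fun j hj => ?_).trans_eq (by ring)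
  have hgap (i : Fin L) (hi : i ∈ Caching.popular C) :
      (μ j).toReal + 5 * (g / 5) ≤ (μ i).toReal := by
    rw [mul_div_cancel₀ g (by norm_num)]
    exact hμ i j (Caching.mem_popular.1 hi) (not_lt.1 fun h => hj (Caching.mem_popular.2 h))
  have hj1 : (μ j).toReal + g / 5 ≤ 1 := by
    have := hgap ⟨0, j.pos⟩ (Caching.mem_popular.2 hC)
    linarith [Caching.toReal_apply_le_one μ ⟨0, j.pos⟩]
  exact (Caching.sum_mpsLaw_mem_topC_le μ hCL hj hd hgap hj1 (by omega) (Nat.le_ceil _)).trans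
    (ENNReal.ofReal_le_ofReal hrate)

theorem mainTheorem5 :
    ∃ K : ℝ → ℝ, ∀ (L C : ℕ) (_hC : 0 < C) (hCL : C < L) (μ : PMF (Fin L)) (_hμ : StrictAnti μ)
      (T : ℕ) (_hT : 2 ≤ T),
      MeasureTheory.Integrable (Caching.regret C T) (Caching.mpsLaw μ C) ∧
      ∫ ω, Caching.regret C T ω ∂(Caching.mpsLaw μ C) ≤
        K (Caching.gap μ C hCL) * (((L : ℝ) - C) * C * Real.log T) := by
  obtain ⟨K, hK⟩ := mainTheorem5_general
  exact ⟨K, fun L C hC hCL μ hμ => hK L C hC hCL.le μ _ (Caching.gap_pos hC hCL hμ)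
    fun _ _ => Caching.toReal_add_gap_le hCL hμ.antitone⟩
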